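/- Setting. Let $\Omega\subseteq\mathbb R^d$ be open and let all nets be indexed by $\varepsilon\in(0,1]$, with $O(\cdot)$ referring to $\varepsilon\to0$; $A\subset\subset\Omega$ means that $\overline A$ is a compact subset of $\Omega$. A net $(u_\varepsilon)_\varepsilon$ of real-valued functions in $C^\infty(\Omega)$ is moderate if for every $m\in\mathbb N_0$ and every compact $K\subset\Omega$ there is $a\in\mathbb R$ with $\max_{|\alpha|\le m}\sup_K|\partial^\alpha u_\varepsilon|=O(\varepsilon^a)$, and negligible if for all $m,K$ this quantity is $O(\varepsilon^b)$ for every $b\in\mathbb R$. Real-valued generalized functions on $\Omega$ are classes $G=[(G_\varepsilon)_\varepsilon]$ of moderate nets modulo negligible nets (the real-valued elements of the Colombeau algebra $\mathcal G(\Omega)$). $G$ is harmonic if $\Delta G:=[(\Delta G_\varepsilon)_\varepsilon]=0$ in $\mathcal G(\Omega)$. The ring $\widetilde{\mathbb R}$ of generalized real numbers consists of nets of real numbers that are $O(\varepsilon^{a})$ for some $a$, modulo those that are $O(\varepsilon^b)$ for every $b$; for $\tilde a,\tilde b\in\widetilde{\mathbb R}$ one writes $\tilde a\le\tilde b$ if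 they have representatives with $a_\varepsilon\le b_\varepsilon$ for all $\varepsilon$. The set $\widetilde\Omega_c$ of compactly supported generalized points consists of nets $(x_\varepsilon)_\varepsilon$ in $\Omega$ that lie in a fixed compact subset of $\Omega$ for all small $\varepsilon$, modulo $(x_\varepsilon)\sim(y_\varepsilon)\iff|x_\varepsilon-y_\varepsilon|=O(\varepsilon^p)$ for all $p\ge0$. The point value $G(\tilde x)=[(G_\varepsilon(x_\varepsilon))_\varepsilon]\in\widetilde{\mathbb R}$ is well defined for $\tilde x=[(x_\varepsilon)_\varepsilon]\in\widetilde\Omega_c$. For $\tilde x_0\in\widetilde\Omega_c$ with representative $(x_{0,\varepsilon})_\varepsilon$ and $r>0$, the semi-ball $B(\tilde x_0,r)$ is the set of all $\tilde t\in\widetilde\Omega_c$ that have a representative $(t_\varepsilon)_\varepsilon$ with $|x_{0,\varepsilon}-t_\varepsilon|\le r$ for all $\varepsilon\le1$. Theorem (Maximum principle). Let $G$ be a real-valued harmonic generalized function in the open set $\Omega$. (1) Let $r>0$ and let $\tilde x_0\in\widetilde\Omega_c$ with representative $(x_{0,\varepsilon})_\varepsilon$ be such that $B(x_{0,\varepsilon},2r)\subset\subset\Omega$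 for every $\varepsilon\le1$. If $G(\tilde x_0)\ge G(\tilde t)$ for every $\tilde t\in B(\tilde x_0,r)$, then $G$ is constant on $B(\tilde x_0,r)$: there is $\tilde c\in\widetilde{\mathbb R}$ with $G(\tilde t)=\tilde c$ for all $\tilde t\in B(\tilde x_0,r)$. (2) Let $\Omega$ be connected. If there is $\tilde x_0\in\widetilde\Omega_c$ with $G(\tilde x_0)\ge G(\tilde t)$ for every $\tilde t\in\widetilde\Omega_c$, then $G$ is a constant generalized function in $\Omega$: there is $\tilde c=[(c_\varepsilon)_\varepsilon]\in\widetilde{\mathbb R}$ with $G=[(c_\varepsilon)_\varepsilon]$ in $\mathcal G(\Omega)$. -/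

import Mathlib

open Filter Topology Asymptotics TopologicalSpace
open scoped ContDiff

noncomputable section

namespace Colombeau

/-- The index set `(0, 1]` of all nets. -/
abbrev Eps : Type := Set.Ioc (0 : ℝ) 1

/-- The filter `ε → 0` on `(0, 1]`; "for all sufficiently small `ε`" is `∀ᶠ ε in toZero`. -/
def toZero : Filter Eps := comap (fun ε : Eps => (ε : ℝ)) (𝓝 0)

/-- `ℝ^d` with the Euclidean norm. -/
abbrev Eucl (d : ℕ) : Type := EuclideanSpace ℝ (Fin d)

lemma tendsto_toZero : Tendsto (fun ε : Eps => (ε : ℝ)) toZero (𝓝 0) := tendsto_comap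

lemma rpow_isBigO_rpow {a b : ℝ} (h : a ≤ b) :
    (fun ε : Eps => (ε : ℝ) ^ b) =O[toZero] fun ε : Eps => (ε : ℝ) ^ a := by
  refine IsBigO.of_bound 1 (Eventually.of_forall fun ε => ?_)
  rw [Real.norm_of_nonneg (Real.rpow_nonneg ε.2.1.le _),
    Real.norm_of_nonneg (Real.rpow_nonneg ε.2.1.le _), one_mul]
  exact Real.rpow_le_rpow_of_exponent_ge ε.2.1 ε.2.2 h

/-! ### Generalized numbers -/

/-- Moderate nets of numbers. -/
def moderateNum (V : Type*) [NormedAddCommGroup V] [NormedSpace ℝ V] : Submodule ℝ (Eps → V) where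
  carrier := {c | ∃ a : ℝ, c =O[toZero] fun ε : Eps => (ε : ℝ) ^ a}
  zero_mem' := ⟨0, isBigO_zero _ _⟩
  add_mem' := by
    rintro c c' ⟨a, ha⟩ ⟨b, hb⟩
    exact ⟨min a b, (ha.trans (rpow_isBigO_rpow (min_le_left a b))).add
      (hb.trans (rpow_isBigO_rpow (min_le_right a b)))⟩
  smul_mem' := by
    rintro t c ⟨a, ha⟩
    exact ⟨a, ha.const_smul_left t⟩

/-- Negligible nets of numbers. -/
def negligibleNum (V : Type*) [NormedAddCommGroup V] [NormedSpace ℝ V] : Submodule ℝ (Eps → V) where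
  carrier := {c | ∀ b : ℝ, c =O[toZero] fun ε : Eps => (ε : ℝ) ^ b}
  zero_mem' := fun _ => isBigO_zero _ _
  add_mem' := fun h h' b => (h b).add (h' b)
  smul_mem' := fun t _ h b => (h b).const_smul_left t

/-- Generalized numbers: moderate nets modulo negligible nets. -/
def GenNum (V : Type*) [NormedAddCommGroup V] [NormedSpace ℝ V] : Type _ :=
  moderateNum V ⧸ (negligibleNum V).submoduleOf (moderateNum V)

instance (V : Type*) [NormedAddCommGroup V] [NormedSpace ℝ V] : AddCommGroup (GenNum V) :=
  inferInstanceAs (AddCommGroup (moderateNum V ⧸ (negligibleNum V).submoduleOf (moderateNum V)))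

instance (V : Type*) [NormedAddCommGroup V] [NormedSpace ℝ V] : Module ℝ (GenNum V) :=
  inferInstanceAs (Module ℝ (moderateNum V ⧸ (negligibleNum V).submoduleOf (moderateNum V)))

/-- The class of a moderate net of numbers. -/
def GenNum.mk {V : Type*} [NormedAddCommGroup V] [NormedSpace ℝ V] : moderateNum V →ₗ[ℝ] GenNum V :=
  ((negligibleNum V).submoduleOf (moderateNum V)).mkQ

/-- The order of the generalized real numbers: `a ≤ b` if there are representatives with
`a_ε ≤ b_ε` for all `ε`. -/
instance : LE (GenNum ℝ) where
  le a b := ∃ u v : moderateNum ℝ, GenNum.mk u = a ∧ GenNum.mk v = b ∧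
    ∀ ε, (u : Eps → ℝ) ε ≤ (v : Eps → ℝ) ε

/-! ### Generalized functions

A smooth function on the open set `Ω` is given here as a total function on `ℝ^d` that is smooth on
`Ω`. All conditions below only see its values on `Ω`: two nets that agree on `Ω` differ by a
negligible net, so the values off `Ω` disappear in the quotient. -/

/-- `f_ε(x) = O(ε^a)`, uniformly for `x ∈ K`. -/
def UnifBigO {d : ℕ} {F : Type*} [Norm F] (f : Eps → Eucl d → F) (K : Set (Eucl d)) (a : ℝ) :
    Prop :=
  (fun p : Eps × Eucl d => f p.1 p.2) =O[toZero ×ˢ 𝓟 K] fun p : Eps × Eucl d => (p.1 : ℝ) ^ a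

lemma unifBigO_iff {d : ℕ} {F : Type*} [Norm F] {f : Eps → Eucl d → F} {K : Set (Eucl d)}
    {a : ℝ} : UnifBigO f K a ↔
      ∃ C : ℝ, ∀ᶠ ε in toZero, ∀ x ∈ K, ‖f ε x‖ ≤ C * (ε : ℝ) ^ a := by
  unfold UnifBigO
  rw [isBigO_iff]
  refine exists_congr fun C => ?_
  rw [eventually_prod_principal_iff]
  refine eventually_congr (Eventually.of_forall fun ε => ?_)
  simp only [Real.norm_of_nonneg (Real.rpow_nonneg ε.2.1.le _)]

section UnifBigO

variable {d : ℕ} {F F' : Type*} [SeminormedAddCommGroup F] [SeminormedAddCommGroup F']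
  {f g : Eps → Eucl d → F} {K : Set (Eucl d)} {a b : ℝ}

lemma UnifBigO.mono_exp (hf : UnifBigO f K b) (h : a ≤ b) : UnifBigO f K a :=
  hf.trans ((rpow_isBigO_rpow h).comp_tendsto tendsto_fst)

lemma UnifBigO.add (hf : UnifBigO f K a) (hg : UnifBigO g K a) :
    UnifBigO (fun ε x => f ε x + g ε x) K a := IsBigO.add hf hg

lemma UnifBigO.of_norm_le {f' : Eps → Eucl d → F'} (C : ℝ) (hf : UnifBigO f K a)
    (h : ∀ ε, ∀ x ∈ K, ‖f' ε x‖ ≤ C * ‖f ε x‖) : UnifBigO f' K a := by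
  refine IsBigO.trans (IsBigO.of_bound C ?_) hf
  rw [eventually_prod_principal_iff]
  exact Eventually.of_forall h

end UnifBigO

section Functions

variable {d : ℕ} (V : Type*) [NormedAddCommGroup V] [NormedSpace ℝ V] (Ω : Opens (Eucl d))

/-- Moderate nets of smooth functions on `Ω`: on each compact subset of `Ω`, the derivatives of
each order are uniformly `O(ε^a)` for some real `a`. -/
def moderate : Submodule ℝ (Eps → Eucl d → V) where
  carrier := {u | (∀ ε, ContDiffOn ℝ ∞ (u ε) Ω) ∧
    ∀ (m : ℕ) (K : Set (Eucl d)), IsCompact K → K ⊆ Ω →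
      ∃ a : ℝ, ∀ k ≤ m, UnifBigO (fun ε => iteratedFDeriv ℝ k (u ε)) K a}
  zero_mem' := by
    refine ⟨fun ε => contDiffOn_const, fun m K _ _ => ⟨0, fun k _ => ?_⟩⟩
    refine unifBigO_iff.2 ⟨0, Eventually.of_forall fun ε x _ => ?_⟩
    simp [Pi.zero_def]
  add_mem' := by
    rintro u v ⟨hu, hu'⟩ ⟨hv, hv'⟩
    refine ⟨fun ε => (hu ε).add (hv ε), fun m K hK hKΩ => ?_⟩
    obtain ⟨a, ha⟩ := hu' m K hK hKΩ
    obtain ⟨b, hb⟩ := hv' m K hK hKΩ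
    refine ⟨min a b, fun k hk => ?_⟩
    refine (((ha k hk).mono_exp (min_le_left a b)).add
      ((hb k hk).mono_exp (min_le_right a b))).of_norm_le 1 fun ε x hx => ?_
    have h1 := ((hu ε).contDiffAt (Ω.isOpen.mem_nhds (hKΩ hx))).of_le
      (show (k : WithTop ℕ∞) ≤ ∞ from mod_cast le_top)
    have h2 := ((hv ε).contDiffAt (Ω.isOpen.mem_nhds (hKΩ hx))).of_le
      (show (k : WithTop ℕ∞) ≤ ∞ from mod_cast le_top)
    rw [Pi.add_apply, iteratedFDeriv_add_apply h1 h2, one_mul]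
  smul_mem' := by
    rintro t u ⟨hu, hu'⟩
    refine ⟨fun ε => (hu ε).const_smul t, fun m K hK hKΩ => ?_⟩
    obtain ⟨a, ha⟩ := hu' m K hK hKΩ
    refine ⟨a, fun k hk => (ha k hk).of_norm_le ‖t‖ fun ε x hx => ?_⟩
    have h1 := ((hu ε).contDiffAt (Ω.isOpen.mem_nhds (hKΩ hx))).of_le
      (show (k : WithTop ℕ∞) ≤ ∞ from mod_cast le_top)
    rw [Pi.smul_apply, iteratedFDeriv_const_smul_apply h1, norm_smul]

/-- Negligible nets of smooth functions on `Ω`: on each compact subset of `Ω`, the derivatives of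
each order are uniformly `O(ε^b)` for all real `b`. -/
def negligible : Submodule ℝ (Eps → Eucl d → V) where
  carrier := {u | (∀ ε, ContDiffOn ℝ ∞ (u ε) Ω) ∧
    ∀ (m : ℕ) (K : Set (Eucl d)), IsCompact K → K ⊆ Ω →
      ∀ b : ℝ, ∀ k ≤ m, UnifBigO (fun ε => iteratedFDeriv ℝ k (u ε)) K b}
  zero_mem' := by
    refine ⟨fun ε => contDiffOn_const, fun m K _ _ b k _ => ?_⟩
    refine unifBigO_iff.2 ⟨0, Eventually.of_forall fun ε x _ => ?_⟩
    simp [Pi.zero_def]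
  add_mem' := by
    rintro u v ⟨hu, hu'⟩ ⟨hv, hv'⟩
    refine ⟨fun ε => (hu ε).add (hv ε), fun m K hK hKΩ b k hk => ?_⟩
    refine ((hu' m K hK hKΩ b k hk).add (hv' m K hK hKΩ b k hk)).of_norm_le 1 fun ε x hx => ?_
    have h1 := ((hu ε).contDiffAt (Ω.isOpen.mem_nhds (hKΩ hx))).of_le
      (show (k : WithTop ℕ∞) ≤ ∞ from mod_cast le_top)
    have h2 := ((hv ε).contDiffAt (Ω.isOpen.mem_nhds (hKΩ hx))).of_le
      (show (k : WithTop ℕ∞) ≤ ∞ from mod_cast le_top)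
    rw [Pi.add_apply, iteratedFDeriv_add_apply h1 h2, one_mul]
  smul_mem' := by
    rintro t u ⟨hu, hu'⟩
    refine ⟨fun ε => (hu ε).const_smul t, fun m K hK hKΩ b k hk => ?_⟩
    refine (hu' m K hK hKΩ b k hk).of_norm_le ‖t‖ fun ε x hx => ?_
    have h1 := ((hu ε).contDiffAt (Ω.isOpen.mem_nhds (hKΩ hx))).of_le
      (show (k : WithTop ℕ∞) ≤ ∞ from mod_cast le_top)
    rw [Pi.smul_apply, iteratedFDeriv_const_smul_apply h1, norm_smul]

/-- The space `𝒢(Ω)` of Colombeau generalized functions with values in `V` (`ℝ` or `ℂ`):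
moderate nets modulo negligible nets. For `V = ℝ` these are the real-valued generalized functions. -/
def GenFun : Type _ := moderate V Ω ⧸ (negligible V Ω).submoduleOf (moderate V Ω)

instance : AddCommGroup (GenFun V Ω) :=
  inferInstanceAs (AddCommGroup (moderate V Ω ⧸ (negligible V Ω).submoduleOf (moderate V Ω)))

instance : Module ℝ (GenFun V Ω) :=
  inferInstanceAs (Module ℝ (moderate V Ω ⧸ (negligible V Ω).submoduleOf (moderate V Ω)))

variable {V Ω}

/-- The class of a moderate net of smooth functions. -/
def GenFun.mk : moderate V Ω →ₗ[ℝ] GenFun V Ω :=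
  ((negligible V Ω).submoduleOf (moderate V Ω)).mkQ

/-! ### The Laplacian -/

/-- The Laplacian as a continuous linear functional of the second derivative. -/
def traceCLM (d : ℕ) (V : Type*) [NormedAddCommGroup V] [NormedSpace ℝ V] :
    (Eucl d →L[ℝ] Eucl d →L[ℝ] V) →L[ℝ] V :=
  ∑ i : Fin d, (ContinuousLinearMap.apply ℝ V (EuclideanSpace.basisFun (Fin d) ℝ i)).comp
    (ContinuousLinearMap.apply ℝ (Eucl d →L[ℝ] V) (EuclideanSpace.basisFun (Fin d) ℝ i))

lemma laplacian_eq_traceCLM (f : Eucl d → V) :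
    Laplacian.laplacian f = fun x => traceCLM d V (fderiv ℝ (fderiv ℝ f) x) := by
  rw [InnerProductSpace.laplacian_eq_iteratedFDeriv_orthonormalBasis f
    (EuclideanSpace.basisFun (Fin d) ℝ)]
  ext x
  simp [traceCLM, iteratedFDeriv_two_apply]

lemma contDiffOn_fderiv_fderiv {f : Eucl d → V} (hf : ContDiffOn ℝ ∞ f Ω) :
    ContDiffOn ℝ ∞ (fderiv ℝ (fderiv ℝ f)) Ω :=
  (hf.fderiv_of_isOpen (m := ∞) Ω.isOpen (by simp)).fderiv_of_isOpen Ω.isOpen (by simp)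

lemma contDiffOn_laplacian {f : Eucl d → V} (hf : ContDiffOn ℝ ∞ f Ω) :
    ContDiffOn ℝ ∞ (Laplacian.laplacian f) Ω := by
  rw [laplacian_eq_traceCLM]
  exact (traceCLM d V).contDiff.comp_contDiffOn (contDiffOn_fderiv_fderiv hf)

lemma exists_norm_iteratedFDeriv_comp_le {F : Type*} [NormedAddCommGroup F] [NormedSpace ℝ F]
    (L : F →L[ℝ] V) : ∃ C : ℝ, ∀ (f : Eucl d → F) (x : Eucl d) (k : ℕ), ContDiffAt ℝ ∞ f x →
      ‖iteratedFDeriv ℝ k (fun y => L (f y)) x‖ ≤ C * ‖iteratedFDeriv ℝ k f x‖ :=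
  ⟨‖L‖, fun _ _ k hf => L.norm_iteratedFDeriv_comp_left (n := k) hf
    (show ((k : ℕ) : WithTop ℕ∞) ≤ ∞ from mod_cast le_top)⟩

lemma exists_norm_iteratedFDeriv_laplacian_le (Ω : Opens (Eucl d)) (V : Type*)
    [NormedAddCommGroup V] [NormedSpace ℝ V] :
    ∃ C : ℝ, ∀ (f : Eucl d → V) (x : Eucl d) (k : ℕ), ContDiffOn ℝ ∞ f Ω → x ∈ Ω →
      ‖iteratedFDeriv ℝ k (Laplacian.laplacian f) x‖ ≤ C * ‖iteratedFDeriv ℝ (k + 2) f x‖ := by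
  obtain ⟨C, hC⟩ := exists_norm_iteratedFDeriv_comp_le (d := d)
    (F := Eucl d →L[ℝ] Eucl d →L[ℝ] V) (traceCLM d V)
  refine ⟨C, fun f x k hf hx => ?_⟩
  have h := hC _ x k ((contDiffOn_fderiv_fderiv hf).contDiffAt (Ω.isOpen.mem_nhds hx))
  rw [norm_iteratedFDeriv_fderiv, norm_iteratedFDeriv_fderiv] at h
  rw [laplacian_eq_traceCLM]
  exact h

lemma laplacian_mem_moderate {u : Eps → Eucl d → V} (hu : u ∈ moderate V Ω) :
    (fun ε => Laplacian.laplacian (u ε)) ∈ moderate V Ω := by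
  refine ⟨fun ε => contDiffOn_laplacian (hu.1 ε), fun m K hK hKΩ => ?_⟩
  obtain ⟨a, ha⟩ := hu.2 (m + 2) K hK hKΩ
  obtain ⟨C, hC⟩ := exists_norm_iteratedFDeriv_laplacian_le Ω V
  exact ⟨a, fun k hk => (ha (k + 2) (by omega)).of_norm_le C
    fun ε x hx => hC _ x k (hu.1 ε) (hKΩ hx)⟩

lemma laplacian_sub_mem_negligible {u v : Eps → Eucl d → V} (hu : u ∈ moderate V Ω)
    (hv : v ∈ moderate V Ω) (h : u - v ∈ negligible V Ω) :
    ((fun ε => Laplacian.laplacian (u ε)) - fun ε => Laplacian.laplacian (v ε)) ∈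
      negligible V Ω := by
  refine ⟨fun ε => (contDiffOn_laplacian (hu.1 ε)).sub (contDiffOn_laplacian (hv.1 ε)),
    fun m K hK hKΩ b k hk => ?_⟩
  obtain ⟨C, hC⟩ := exists_norm_iteratedFDeriv_laplacian_le Ω V
  refine (h.2 (m + 2) K hK hKΩ b (k + 2) (by omega)).of_norm_le C fun ε x hx => ?_
  have hev : (Laplacian.laplacian (u ε) - Laplacian.laplacian (v ε)) =ᶠ[𝓝 x]
      Laplacian.laplacian ((u - v) ε) := by
    filter_upwards [Ω.isOpen.mem_nhds (hKΩ hx)] with y hy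
    have h1 := ((hu.1 ε).contDiffAt (Ω.isOpen.mem_nhds hy)).of_le
      (show ((2 : ℕ) : WithTop ℕ∞) ≤ ∞ from WithTop.coe_le_coe.2 le_top)
    have h2 := ((hv.1 ε).contDiffAt (Ω.isOpen.mem_nhds hy)).of_le
      (show ((2 : ℕ) : WithTop ℕ∞) ≤ ∞ from WithTop.coe_le_coe.2 le_top)
    exact (h1.laplacian_sub h2).symm
  have he := (hev.iteratedFDeriv ℝ k).eq_of_nhds
  simp only [Pi.sub_apply] at he ⊢
  rw [he]
  exact hC _ x k (h.1 ε) (hKΩ hx)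

/-- The Laplacian on `𝒢(Ω)`: `Δ [(u_ε)_ε] = [(Δ u_ε)_ε]`. -/
def GenFun.laplacian : GenFun V Ω → GenFun V Ω :=
  Quotient.lift
    (fun u : moderate V Ω => GenFun.mk ⟨fun ε => Laplacian.laplacian (u.1 ε),
      laplacian_mem_moderate u.2⟩)
    fun u v h => by
      have h' : u - v ∈ (negligible V Ω).submoduleOf (moderate V Ω) :=
        (Submodule.quotientRel_def _).1 h
      exact (Submodule.Quotient.eq _).2 (laplacian_sub_mem_negligible u.2 v.2 h')

/-- `G` is a harmonic generalized function if `Δ G = 0` in `𝒢(Ω)`. -/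
def GenFun.IsHarmonic (G : GenFun V Ω) : Prop := G.laplacian = 0

/-! ### Constant generalized functions -/

lemma const_mem_moderate {c : Eps → V} (hc : c ∈ moderateNum V) :
    (fun ε (_ : Eucl d) => c ε) ∈ moderate V Ω := by
  obtain ⟨a, ha⟩ := hc
  refine ⟨fun ε => contDiffOn_const, fun m K hK hKΩ => ⟨a, fun k hk => ?_⟩⟩
  have h0 : UnifBigO (fun ε (_ : Eucl d) => c ε) K a := ha.comp_tendsto tendsto_fst
  refine h0.of_norm_le 1 fun ε x hx => ?_
  rcases Nat.eq_zero_or_pos k with rfl | hk0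
  · rw [norm_iteratedFDeriv_zero, one_mul]
  · rw [iteratedFDeriv_const_of_ne hk0.ne']
    simp

lemma const_mem_negligible {c : Eps → V} (hc : c ∈ negligibleNum V) :
    (fun ε (_ : Eucl d) => c ε) ∈ negligible V Ω := by
  refine ⟨fun ε => contDiffOn_const, fun m K hK hKΩ b k hk => ?_⟩
  have h0 : UnifBigO (fun ε (_ : Eucl d) => c ε) K b := (hc b).comp_tendsto tendsto_fst
  refine h0.of_norm_le 1 fun ε x hx => ?_
  rcases Nat.eq_zero_or_pos k with rfl | hk0
  · rw [norm_iteratedFDeriv_zero, one_mul]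
  · rw [iteratedFDeriv_const_of_ne hk0.ne']
    simp

/-- The generalized function on `Ω` that is constant, equal to the generalized number `c`. -/
def GenFun.const (Ω : Opens (Eucl d)) : GenNum V → GenFun V Ω :=
  Quotient.lift
    (fun c : moderateNum V => GenFun.mk ⟨fun ε _ => c.1 ε, const_mem_moderate c.2⟩)
    fun c c' h => by
      have h' : c - c' ∈ (negligibleNum V).submoduleOf (moderateNum V) :=
        (Submodule.quotientRel_def _).1 h
      exact (Submodule.Quotient.eq _).2
        (const_mem_negligible (c := (c : Eps → V) - (c' : Eps → V)) h')

end Functions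

/-! ### Compactly supported generalized points -/

section Points

variable {d : ℕ} (Ω : Opens (Eucl d))

/-- Nets of points of `Ω` that lie in a compact subset of `Ω` for small `ε`. Such nets are
automatically moderate. -/
def CompactNet : Type :=
  {x : Eps → Eucl d // (∀ ε, x ε ∈ Ω) ∧
    ∃ K : Set (Eucl d), IsCompact K ∧ K ⊆ Ω ∧ ∀ᶠ ε in toZero, x ε ∈ K}

/-- `(x_ε) ∼ (y_ε)` if `|x_ε - y_ε| = O(ε^p)` for all `p ≥ 0`. -/
instance compactNetSetoid : Setoid (CompactNet Ω) where
  r x y := ∀ p : ℝ, 0 ≤ p →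
    (fun ε => dist (x.1 ε) (y.1 ε)) =O[toZero] fun ε : Eps => (ε : ℝ) ^ p
  iseqv :=
    { refl := fun x p _ => by simpa using isBigO_zero _ _
      symm := fun {x y} h p hp => by simpa only [dist_comm] using h p hp
      trans := fun {x y z} h h' p hp => by
        refine IsBigO.trans (IsBigO.of_bound 1 (Eventually.of_forall fun ε => ?_))
          ((h p hp).add (h' p hp))
        rw [Real.norm_of_nonneg dist_nonneg, Real.norm_of_nonneg (by positivity), one_mul]
        exact dist_triangle _ _ _ }

/-- The set `Ω̃_c` of compactly supported generalized points of `Ω`. -/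
def CompactPoint : Type := Quotient (compactNetSetoid Ω)

variable {Ω}

/-- The class of a compactly supported net of points. -/
def CompactPoint.mk (x : CompactNet Ω) : CompactPoint Ω := Quotient.mk _ x

/-! ### Point values -/

variable {V : Type*} [NormedAddCommGroup V] [NormedSpace ℝ V]

lemma eval_mem_moderateNum {u : Eps → Eucl d → V} (hu : u ∈ moderate V Ω) (x : CompactNet Ω) :
    (fun ε => u ε (x.1 ε)) ∈ moderateNum V := by
  obtain ⟨K, hK, hKΩ, hxK⟩ := x.2.2
  obtain ⟨a, ha⟩ := hu.2 0 K hK hKΩ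
  obtain ⟨C, hC⟩ := unifBigO_iff.1 (ha 0 le_rfl)
  refine ⟨a, IsBigO.of_bound C ?_⟩
  filter_upwards [hC, hxK] with ε h1 h2
  have := h1 _ h2
  rwa [norm_iteratedFDeriv_zero, ← Real.norm_of_nonneg (Real.rpow_nonneg ε.2.1.le a)] at this

lemma eval_sub_mem_negligibleNum {u v : Eps → Eucl d → V} (hv : v ∈ moderate V Ω)
    (h : u - v ∈ negligible V Ω) {x y : CompactNet Ω} (hxy : x ≈ y) :
    ((fun ε => u ε (x.1 ε)) - fun ε => v ε (y.1 ε)) ∈ negligibleNum V := by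
  intro b
  obtain ⟨K, hK, hKΩ, hxK⟩ := x.2.2
  have h1 : (fun ε => u ε (x.1 ε) - v ε (x.1 ε)) =O[toZero] fun ε : Eps => (ε : ℝ) ^ b := by
    obtain ⟨C, hC⟩ := unifBigO_iff.1 (h.2 0 K hK hKΩ b 0 le_rfl)
    refine IsBigO.of_bound C ?_
    filter_upwards [hC, hxK] with ε h1 h2
    have := h1 _ h2
    rwa [norm_iteratedFDeriv_zero, ← Real.norm_of_nonneg (Real.rpow_nonneg ε.2.1.le b)] at this
  have h2 : (fun ε => v ε (x.1 ε) - v ε (y.1 ε)) =O[toZero] fun ε : Eps => (ε : ℝ) ^ b := by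
    obtain ⟨δ, hδ, hδΩ⟩ := hK.exists_cthickening_subset_open Ω.isOpen hKΩ
    obtain ⟨a, ha⟩ := hv.2 1 _ (hK.cthickening (r := δ)) hδΩ
    obtain ⟨C, hC⟩ := unifBigO_iff.1 (ha 1 le_rfl)
    obtain ⟨D, hD⟩ := (hxy (max (b - a) 0) (le_max_right _ _)).trans
      (rpow_isBigO_rpow (le_max_left (b - a) 0)) |>.bound
    have hsmall : ∀ᶠ ε : Eps in toZero, dist (x.1 ε) (y.1 ε) < δ := by
      have ht : Tendsto (fun ε : Eps => (ε : ℝ) ^ (1 : ℝ)) toZero (𝓝 0) := by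
        simpa using tendsto_toZero
      exact ((hxy 1 zero_le_one).trans_tendsto ht).eventually (gt_mem_nhds hδ)
    refine IsBigO.of_bound (C * D) ?_
    filter_upwards [hC, hD, hsmall, hxK] with ε h1 h2 h3 h4
    have hball : Metric.closedBall (x.1 ε) δ ⊆ Metric.cthickening δ K :=
      Metric.closedBall_subset_cthickening h4 δ
    have hC0 : 0 ≤ C * (ε : ℝ) ^ a :=
      (norm_nonneg _).trans (h1 _ (hball (Metric.mem_closedBall_self hδ.le)))
    have hmv := (convex_closedBall (x.1 ε) δ).norm_image_sub_le_of_norm_fderiv_le (𝕜 := ℝ)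
      (f := v ε) (C := C * (ε : ℝ) ^ a) (x := y.1 ε) (y := x.1 ε)
      (fun z hz => ((hv.1 ε).contDiffAt (Ω.isOpen.mem_nhds (hδΩ (hball hz)))).differentiableAt
        (by simp))
      (fun z hz => by rw [← norm_iteratedFDeriv_one]; exact h1 z (hball hz))
      (by rw [Metric.mem_closedBall, dist_comm]; exact h3.le) (Metric.mem_closedBall_self hδ.le)
    rw [Real.norm_of_nonneg dist_nonneg,
      Real.norm_of_nonneg (Real.rpow_nonneg ε.2.1.le _)] at h2
    rw [Real.norm_of_nonneg (Real.rpow_nonneg ε.2.1.le _)]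
    calc ‖v ε (x.1 ε) - v ε (y.1 ε)‖ ≤ C * (ε : ℝ) ^ a * ‖x.1 ε - y.1 ε‖ := hmv
      _ ≤ C * (ε : ℝ) ^ a * (D * (ε : ℝ) ^ (b - a)) := by
        rw [← dist_eq_norm]; exact mul_le_mul_of_nonneg_left h2 hC0
      _ = C * D * (ε : ℝ) ^ b := by
        rw [show b = a + (b - a) by ring, Real.rpow_add ε.2.1]; ring_nf
  refine (h1.add h2).congr_left fun ε => ?_
  simp

/-- The point value `G(x̃) = [(G_ε(x_ε))_ε]` of a generalized function at a compactly supported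
generalized point. -/
def GenFun.eval (G : GenFun V Ω) (x : CompactPoint Ω) : GenNum V :=
  Quotient.lift₂
    (fun (u : moderate V Ω) (x : CompactNet Ω) =>
      GenNum.mk ⟨fun ε => u.1 ε (x.1 ε), eval_mem_moderateNum u.2 x⟩)
    (fun u x v y h hxy => by
      have h' : u - v ∈ (negligible V Ω).submoduleOf (moderate V Ω) :=
        (Submodule.quotientRel_def _).1 h
      exact (Submodule.Quotient.eq _).2 (eval_sub_mem_negligibleNum v.2 h' hxy)) G x

/-- The semi-ball `B(x̃₀, r)` about the compactly supported point with representative `x₀`: all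
`t̃ ∈ Ω̃_c` with a representative such that `|x_{0,ε} - t_ε| ≤ r` for every `ε ≤ 1`. -/
def semiBall (x₀ : CompactNet Ω) (r : ℝ) : Set (CompactPoint Ω) :=
  {t | ∃ t' : CompactNet Ω, CompactPoint.mk t' = t ∧ ∀ ε, ‖x₀.1 ε - t'.1 ε‖ ≤ r}

end Points

/-- `A ⊂⊂ Ω`: the closure of `A` is compact and contained in `Ω`. -/
def CompactlyContained {d : ℕ} (A : Set (Eucl d)) (Ω : Opens (Eucl d)) : Prop :=
  IsCompact (closure A) ∧ closure A ⊆ Ω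

end Colombeau

end

noncomputable section

namespace Colombeau

open MeasureTheory Metric

/-! ### A weighted mean value property -/

section MeanValue

variable {d : ℕ}

/-! A harmonic generalized function has representatives whose Laplacians are only negligible, and
its maximum is attained only up to negligible errors, so the classical principle is replaced by a
quantitative one. Let `w = (1 - |y|²)₊`. Since `∇(w²) = -4 w y`, integration by parts shows that the
`w`-weighted mean of `f` over a ball differs from a multiple of the value at the centre by at most a
constant times `sup |Δf|`. If `f ≤ f x₀ + η` and `|Δf| ≤ η`, then `H = f x₀ + η - f` is nonnegative
with weighted integral `O(η)`. If `H > δ` somewhere and `|∇f| ≤ L`, then `H ≥ δ/2` on a ball of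
radius comparable to `δ/L`, which forces `η ≥ c (δ/L)^(d+1) δ`; this is
`sub_le_of_le_add_of_abs_laplacian_le`.

For a moderate net, `L` is at most a power of `ε`, while `η` may be any power. Hence `δ` may be any
power too, which gives part (1) (`eventually_abs_sub_le_of_le_add`).

For part (2) this local statement is propagated through the connected set `Ω`. The maximum point
moves with `ε` and need not converge, so the argument runs along an ultrafilter finer than `ε → 0`,
where it does (`eventually_abs_sub_le_of_isConnected`). Estimates along all such ultrafilters give
the estimate for `ε → 0`, and a Landau inequality upgrades smallness of values to smallness of all
derivatives (`mem_negligible_of_mem_moderate`). -/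

/-- The weight `(1 - |y|²)₊`. -/
def ballWeight (y : Eucl d) : ℝ := max 0 (1 - ‖y‖ ^ 2)

lemma ballWeight_nonneg (y : Eucl d) : 0 ≤ ballWeight y := le_max_left _ _

lemma continuous_ballWeight : Continuous (ballWeight (d := d)) := by
  unfold ballWeight; fun_prop

lemma ballWeight_eq_zero {y : Eucl d} (hy : 1 ≤ ‖y‖) : ballWeight y = 0 :=
  max_eq_left (by nlinarith)

lemma one_sub_norm_le_ballWeight {y : Eucl d} (hy : ‖y‖ ≤ 1) : 1 - ‖y‖ ≤ ballWeight y :=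
  le_max_of_le_right (by nlinarith [norm_nonneg y])

lemma hasCompactSupport_ballWeight : HasCompactSupport (ballWeight (d := d)) :=
  HasCompactSupport.intro (isCompact_closedBall 0 1) fun y hy =>
    ballWeight_eq_zero (by simpa using (not_le.1 (fun h => hy (by simpa using h))).le)

lemma integrable_ballWeight_mul {g : Eucl d → ℝ} (hg : Continuous g) :
    Integrable fun y => ballWeight y * g y :=
  (continuous_ballWeight.mul hg).integrable_of_hasCompactSupport hasCompactSupport_ballWeight.mul_right

lemma integrable_ballWeight_sq_mul {g : Eucl d → ℝ} (hg : Continuous g) :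
    Integrable fun y => ballWeight y ^ 2 * g y := by
  simpa only [sq, mul_assoc] using
    integrable_ballWeight_mul (g := fun y => ballWeight y * g y) (continuous_ballWeight.mul hg)

/-- Squaring removes the kink of the positive part, so the square of the weight is differentiable
everywhere, the unit sphere included. -/
lemma hasDerivAt_max_zero_sq (t : ℝ) :
    HasDerivAt (fun t : ℝ => max 0 t ^ 2) (2 * max 0 t) t := by
  rcases lt_trichotomy t 0 with h | rfl | h
  · rw [max_eq_left h.le, mul_zero]
    refine (hasDerivAt_const t (0 : ℝ)).congr_of_eventuallyEq ?_
    filter_upwards [gt_mem_nhds h] with s hs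
    simp [max_eq_left hs.le]
  · rw [max_self, mul_zero, hasDerivAt_iff_isLittleO_nhds_zero]
    have h2 : (fun s : ℝ => s ^ 2) =o[𝓝 0] fun s : ℝ => s := by
      simpa using isLittleO_pow_id (𝕜 := ℝ) (n := 2) (by norm_num)
    refine IsBigO.trans_isLittleO (IsBigO.of_bound 1 (Eventually.of_forall fun s => ?_)) h2
    rcases le_total s 0 with hs | hs
    · simp [max_eq_left hs]; positivity
    · simp [max_eq_right hs]
  · rw [max_eq_right h.le]
    have h0 : HasDerivAt (fun t : ℝ => t ^ 2) (2 * t) t := by simpa using hasDerivAt_pow 2 t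
    refine h0.congr_of_eventuallyEq ?_
    filter_upwards [lt_mem_nhds h] with s hs
    simp [max_eq_right hs.le]

/-- The reason for this weight: the radial field `w y` is `-∇(w²)/4`. -/
lemma hasFDerivAt_ballWeight_sq (y : Eucl d) :
    HasFDerivAt (fun y : Eucl d => ballWeight y ^ 2) (-(4 * ballWeight y) • innerSL ℝ y) y := by
  have h1 : HasFDerivAt (fun y : Eucl d => 1 - ‖y‖ ^ 2) (-(2 • innerSL ℝ y)) y :=
    ((hasStrictFDerivAt_norm_sq y).hasFDerivAt).const_sub 1
  have h := (hasDerivAt_max_zero_sq (1 - ‖y‖ ^ 2)).comp_hasFDerivAt y h1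
  refine h.congr_fderiv ?_
  ext v
  simp only [ballWeight, smul_apply, neg_apply,
    smul_eq_mul, nsmul_eq_mul, innerSL_apply_apply]
  push_cast
  ring

/-- Integration by parts in each coordinate, moving the gradient off `w²`; compact support leaves no
boundary term, and the factor `s` comes from the chain rule. -/
lemma integral_ballWeight_mul_fderiv {f : Eucl d → ℝ} (hf : ContDiff ℝ 2 f) (x₀ : Eucl d)
    (s : ℝ) : ∫ y, ballWeight y * fderiv ℝ f (x₀ + s • y) y =
      s / 4 * ∫ y, ballWeight y ^ 2 * Laplacian.laplacian f (x₀ + s • y) := by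
  have hf1 : ContDiff ℝ 1 (fderiv ℝ f) := hf.fderiv_right (by norm_num)
  have hf1c : Continuous (fderiv ℝ f) := hf1.continuous
  have hf2c : Continuous (fderiv ℝ (fderiv ℝ f)) := hf1.continuous_fderiv (by norm_num)
  have haff : Continuous fun y : Eucl d => x₀ + s • y := by fun_prop
  let e := EuclideanSpace.basisFun (Fin d) ℝ
  let g : Fin d → Eucl d → ℝ := fun i y => fderiv ℝ f (x₀ + s • y) (e i)
  have hgd : ∀ i y, HasFDerivAt (g i)
      (s • (fderiv ℝ (fderiv ℝ f) (x₀ + s • y)).flip (e i)) y := by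
    intro i y
    have h1 : HasFDerivAt (fun y : Eucl d => x₀ + s • y)
        (s • ContinuousLinearMap.id ℝ (Eucl d)) y :=
      ((hasFDerivAt_id y).const_smul s).const_add x₀
    have h2 := ((hf1.differentiable (by norm_num)) (x₀ + s • y)).hasFDerivAt.comp y h1
    have h3 := h2.clm_apply (hasFDerivAt_const (e i) y)
    refine h3.congr_fderiv ?_
    ext v
    simp
  have hgc : ∀ i, Continuous (g i) := fun i => (hf1c.comp haff).clm_apply continuous_const
  have hparts : ∀ i, s * ∫ y, ballWeight y ^ 2 * fderiv ℝ (fderiv ℝ f) (x₀ + s • y) (e i) (e i) =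
      4 * ∫ y, ballWeight y * (g i y * y i) := by
    intro i
    have hA : ∀ y, fderiv ℝ (g i) y (e i) =
        s * fderiv ℝ (fderiv ℝ f) (x₀ + s • y) (e i) (e i) := by
      intro y
      rw [(hgd i y).fderiv]; simp
    have hB : ∀ y : Eucl d, fderiv ℝ (fun y : Eucl d => ballWeight y ^ 2) y (e i) * g i y =
        -4 * (ballWeight y * (g i y * y i)) := by
      intro y
      rw [(hasFDerivAt_ballWeight_sq y).fderiv]
      have : inner ℝ y (e i) = y i := by
        simp [e, EuclideanSpace.inner_single_right]
      simp only [smul_apply, innerSL_apply_apply, this, smul_eq_mul]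
      ring
    have hcont2 : Continuous fun y => fderiv ℝ (fderiv ℝ f) (x₀ + s • y) (e i) (e i) :=
      ((hf2c.comp haff).clm_apply continuous_const).clm_apply continuous_const
    have := integral_mul_fderiv_eq_neg_fderiv_mul_of_integrable (μ := (volume : Measure (Eucl d)))
      (f := fun y : Eucl d => ballWeight y ^ 2) (g := g i) (v := e i)
      (by
        simp_rw [hB]
        exact (integrable_ballWeight_mul ((hgc i).mul (by fun_prop))).const_mul _)
      (by
        simp_rw [hA]
        exact integrable_ballWeight_sq_mul (continuous_const.mul hcont2))
      (integrable_ballWeight_sq_mul (hgc i))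
      (fun y _ => (hasFDerivAt_ballWeight_sq y).differentiableAt)
      (fun y _ => (hgd i y).differentiableAt)
    simp_rw [hA, hB, integral_const_mul] at this
    rw [← integral_const_mul]
    rw [neg_mul, neg_neg] at this
    rw [← this]
    exact integral_congr_ae (Eventually.of_forall fun y => by ring)
  have hL : ∀ y, ballWeight y ^ 2 * Laplacian.laplacian f (x₀ + s • y) =
      ∑ i, ballWeight y ^ 2 * fderiv ℝ (fderiv ℝ f) (x₀ + s • y) (e i) (e i) := by
    intro y
    rw [laplacian_eq_traceCLM, ← Finset.mul_sum]
    simp [traceCLM, e]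
  have hR : ∀ y : Eucl d, ballWeight y * fderiv ℝ f (x₀ + s • y) y =
      ∑ i, ballWeight y * (g i y * y i) := by
    intro y
    rw [← Finset.mul_sum]
    congr 1
    conv_lhs => enter [2]; rw [← e.sum_repr y]
    rw [map_sum]
    refine Finset.sum_congr rfl fun i _ => ?_
    have : e.repr y i = y i := by simp [e]
    rw [this, map_smul, smul_eq_mul, mul_comm]
  simp_rw [hL, hR]
  rw [integral_finsetSum _ fun i _ => integrable_ballWeight_mul (g := fun y => g i y * y i)
      ((hgc i).mul (by fun_prop)),
    integral_finsetSum _ fun i _ => integrable_ballWeight_sq_mul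
      (g := fun y => fderiv ℝ (fderiv ℝ f) (x₀ + s • y) (e i) (e i))
      (((hf2c.comp haff).clm_apply continuous_const).clm_apply continuous_const),
    Finset.mul_sum]
  refine Finset.sum_congr rfl fun i _ => ?_
  linarith [hparts i]

lemma hasDerivAt_integral_ballWeight_mul {f : Eucl d → ℝ} (hf : ContDiff ℝ 1 f) (x₀ : Eucl d)
    (s : ℝ) : HasDerivAt (fun s : ℝ => ∫ y, ballWeight y * f (x₀ + s • y))
      (∫ y, ballWeight y * fderiv ℝ f (x₀ + s • y) y) s := by
  have hf1c : Continuous (fderiv ℝ f) := hf.continuous_fderiv (by norm_num)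
  -- Only `‖y‖ ≤ 1` matters because of the weight, so for `|t - s| < 1` every relevant point `x₀ + t
  -- • y` lies in this ball.
  obtain ⟨B, hB⟩ := (isCompact_closedBall x₀ (|s| + 1)).exists_bound_of_continuousOn
    hf1c.continuousOn
  have hcF : ∀ t : ℝ, Continuous fun y : Eucl d => f (x₀ + t • y) := fun t =>
    hf.continuous.comp (by fun_prop)
  have hcF' : Continuous fun y : Eucl d => fderiv ℝ f (x₀ + s • y) y :=
    (hf1c.comp (by fun_prop)).clm_apply continuous_id
  refine (hasDerivAt_integral_of_dominated_loc_of_deriv_le (μ := (volume : Measure (Eucl d)))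
    (F := fun s y => ballWeight y * f (x₀ + s • y))
    (F' := fun s y => ballWeight y * fderiv ℝ f (x₀ + s • y) y)
    (bound := fun y => ballWeight y * B) (ball_mem_nhds s one_pos)
    (Eventually.of_forall fun t => (integrable_ballWeight_mul (hcF t)).aestronglyMeasurable)
    (integrable_ballWeight_mul (hcF s))
    (integrable_ballWeight_mul hcF').aestronglyMeasurable
    (Eventually.of_forall fun y t ht => ?_)
    (integrable_ballWeight_mul continuous_const)
    (Eventually.of_forall fun y t ht => ?_)).2
  · rcases le_total 1 ‖y‖ with hy | hy
    · simp [ballWeight_eq_zero hy]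
    · rw [norm_mul, Real.norm_of_nonneg (ballWeight_nonneg y)]
      refine mul_le_mul_of_nonneg_left ?_ (ballWeight_nonneg y)
      have ht' : |t| ≤ |s| + 1 := by
        have := mem_ball_iff_norm.1 ht
        rw [Real.norm_eq_abs] at this
        have h2 := abs_add_le (t - s) s
        rw [sub_add_cancel] at h2
        linarith
      have hmem : x₀ + t • y ∈ closedBall x₀ (|s| + 1) := by
        rw [mem_closedBall_iff_norm, add_sub_cancel_left, norm_smul, Real.norm_eq_abs]
        nlinarith [norm_nonneg y, abs_nonneg t]
      calc ‖fderiv ℝ f (x₀ + t • y) y‖ ≤ ‖fderiv ℝ f (x₀ + t • y)‖ * ‖y‖ :=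
            ContinuousLinearMap.le_opNorm _ _
        _ ≤ ‖fderiv ℝ f (x₀ + t • y)‖ * 1 := mul_le_mul_of_nonneg_left hy (norm_nonneg _)
        _ ≤ B := by rw [mul_one]; exact hB _ hmem
  · have h1 : HasDerivAt (fun t : ℝ => x₀ + t • y) y t := by
      simpa using ((hasDerivAt_id t).smul_const y).const_add x₀
    exact ((((hf.differentiable (by norm_num)) _).hasFDerivAt.comp_hasDerivAt t h1)).const_mul _

/-- Mean value inequality in the radius `s ∈ [0, r]`: the derivative of the weighted mean is `s / 4`
times the integral of `w² Δf`, and `s` is bounded by `r`. -/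
lemma abs_integral_ballWeight_sub_le {f : Eucl d → ℝ} (hf : ContDiff ℝ 2 f) {x₀ : Eucl d}
    {r η : ℝ} (hr : 0 ≤ r) (hη : ∀ x ∈ closedBall x₀ r, |Laplacian.laplacian f x| ≤ η) :
    |(∫ y, ballWeight y * f (x₀ + r • y)) - (∫ y : Eucl d, ballWeight y) * f x₀| ≤
      r ^ 2 / 4 * (∫ y : Eucl d, ballWeight y ^ 2) * η := by
  have hη0 : 0 ≤ η := (abs_nonneg _).trans (hη x₀ (mem_closedBall_self hr))
  have hI : 0 ≤ ∫ y : Eucl d, ballWeight y ^ 2 := integral_nonneg fun y => sq_nonneg _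
  have hLc : Continuous (Laplacian.laplacian f) := by
    rw [laplacian_eq_traceCLM]
    exact (traceCLM d ℝ).continuous.comp
      ((hf.fderiv_right (m := 1) (by norm_num)).continuous_fderiv (by norm_num))
  have key := (convex_Icc (0 : ℝ) r).norm_image_sub_le_of_norm_hasDerivWithin_le
    (f := fun s : ℝ => ∫ y, ballWeight y * f (x₀ + s • y))
    (C := r / 4 * ((∫ y : Eucl d, ballWeight y ^ 2) * η)) (x := 0) (y := r)
    (fun s _ => (hasDerivAt_integral_ballWeight_mul (hf.of_le (by norm_num)) x₀ s).hasDerivWithinAt)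
    (fun s hs => by
      rw [integral_ballWeight_mul_fderiv hf, norm_mul, Real.norm_of_nonneg (by linarith [hs.1])]
      refine mul_le_mul (by linarith [hs.2]) ?_ (norm_nonneg _) (by linarith)
      rw [← integral_mul_const]
      refine norm_integral_le_of_norm_le ?_ (Eventually.of_forall fun y => ?_)
      · exact integrable_ballWeight_sq_mul continuous_const
      · rcases le_total 1 ‖y‖ with hy | hy
        · simp [ballWeight_eq_zero hy]
        · rw [norm_mul, Real.norm_of_nonneg (sq_nonneg _)]
          refine mul_le_mul_of_nonneg_left (hη _ ?_) (sq_nonneg _)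
          rw [mem_closedBall_iff_norm, add_sub_cancel_left, norm_smul, Real.norm_of_nonneg hs.1]
          nlinarith [norm_nonneg y, hs.1, hs.2])
    (Set.left_mem_Icc.2 hr) (Set.right_mem_Icc.2 hr)
  simp only [zero_smul, add_zero, integral_mul_const, sub_zero, Real.norm_eq_abs,
    abs_of_nonneg hr] at key
  calc _ ≤ _ := key
    _ = _ := by ring

/-! ### Quantitative maximum principle on a ball -/

/-- A quantitative strong maximum principle: if `f ≤ f x₀ + η` and `|Δ f| ≤ η` on a closed ball
about `x₀`, then `f` is almost constant there. -/
lemma sub_le_of_le_add_of_abs_laplacian_le (d : ℕ) {r : ℝ} (hr : 0 < r) :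
    ∃ c : ℝ, 0 < c ∧ ∀ (f : Eucl d → ℝ) (x₀ : Eucl d) (L η δ : ℝ), ContDiff ℝ 2 f →
      (∀ x ∈ closedBall x₀ r, |Laplacian.laplacian f x| ≤ η) →
      (∀ x ∈ closedBall x₀ r, ‖fderiv ℝ f x‖ ≤ L) →
      (∀ x ∈ closedBall x₀ r, f x ≤ f x₀ + η) →
      0 < δ → 0 < L → δ ≤ L * r → η < c * (δ / L) ^ (d + 1) * δ →
      ∀ x ∈ closedBall x₀ r, f x₀ + η - f x ≤ δ := by
  set I₁ := ∫ y : Eucl d, ballWeight y with hI₁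
  set I₂ := ∫ y : Eucl d, ballWeight y ^ 2 with hI₂
  have hI1 : 0 ≤ I₁ := integral_nonneg fun y => ballWeight_nonneg y
  have hI2 : 0 ≤ I₂ := integral_nonneg fun y => sq_nonneg _
  set v := (volume (ball (0 : Eucl d) 1)).toReal with hv
  have hv0 : 0 < v := ENNReal.toReal_pos (measure_ball_pos _ _ one_pos).ne' measure_ball_lt_top.ne
  -- `I₁` accounts for the `η` inside `H`, the next term for the mean value error; the `1` only
  -- makes positivity immediate.
  set C := I₁ + r ^ 2 / 4 * I₂ + 1 with hC
  have hC0 : 0 < C := by positivity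
  refine ⟨v * (8 * r)⁻¹ ^ (d + 1) / (2 * C), by positivity, ?_⟩
  intro f x₀ L η δ hf hΔ hL hmax hδ hL0 hδL hη z hz
  by_contra! hlt
  have hη0 : 0 ≤ η := (abs_nonneg _).trans (hΔ x₀ (mem_closedBall_self hr.le))
  -- rescale to the unit ball
  set H : Eucl d → ℝ := fun y => f x₀ + η - f (x₀ + r • y) with hH
  have hmemb : ∀ y : Eucl d, ‖y‖ ≤ 1 → x₀ + r • y ∈ closedBall x₀ r := by
    intro y hy
    rw [mem_closedBall_iff_norm, add_sub_cancel_left, norm_smul, Real.norm_of_nonneg hr.le]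
    nlinarith
  have hHc : Continuous H := by
    have := hf.continuous
    fun_prop
  have hH0 : ∀ y : Eucl d, ‖y‖ ≤ 1 → 0 ≤ H y := fun y hy => by
    have := hmax _ (hmemb y hy)
    simp only [hH]; linarith
  have hwH : ∀ y : Eucl d, 0 ≤ ballWeight y * H y := by
    intro y
    rcases le_total 1 ‖y‖ with hy | hy
    · simp [ballWeight_eq_zero hy]
    · exact mul_nonneg (ballWeight_nonneg y) (hH0 y hy)
  have hupper : ∫ y, ballWeight y * H y ≤ C * η := by
    have h1 := abs_integral_ballWeight_sub_le hf hr.le hΔ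
    have h2 : ∫ y, ballWeight y * H y =
        I₁ * (f x₀ + η) - ∫ y, ballWeight y * f (x₀ + r • y) := by
      rw [hI₁, ← integral_mul_const, ← integral_sub (integrable_ballWeight_mul continuous_const)
        (integrable_ballWeight_mul (g := fun y => f (x₀ + r • y))
          (hf.continuous.comp (by fun_prop)))]
      exact integral_congr_ae (Eventually.of_forall fun y => by simp only [hH]; ring)
    rw [h2]
    have h3 := (abs_le.1 h1).1
    rw [hC]
    nlinarith
  obtain ⟨z', hz', rfl⟩ : ∃ z' : Eucl d, ‖z'‖ ≤ 1 ∧ x₀ + r • z' = z := by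
    refine ⟨r⁻¹ • (z - x₀), ?_, ?_⟩
    · rw [norm_smul, norm_inv, Real.norm_of_nonneg hr.le, inv_mul_le_iff₀ hr, mul_one]
      exact mem_closedBall_iff_norm.1 hz
    · rw [smul_smul, mul_inv_cancel₀ hr.ne', one_smul, add_sub_cancel]
  -- A displacement `ρ` in the unit ball changes `f` by at most `L * r * ρ = δ / 2`.
  set ρ := δ / (2 * (L * r)) with hρ
  have hρ0 : 0 < ρ := by positivity
  have hρ1 : ρ ≤ 1 := by
    rw [hρ, div_le_one (by positivity)]
    nlinarith
  -- The weight vanishes if `z'` is on the unit sphere, so the centre is pulled inwards: the ball of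
  -- radius `ρ / 4` about `q` stays within `ρ` of `z'`, and the weight is at least `ρ / 4` on it.
  set q := (1 - ρ / 2) • z' with hq
  have hqn : ‖q‖ ≤ 1 - ρ / 2 := by
    rw [hq, norm_smul, Real.norm_of_nonneg (by linarith)]
    nlinarith
  have hball : ∀ y ∈ ball q (ρ / 4), ρ / 4 * (δ / 2) ≤ ballWeight y * H y := by
    intro y hy
    have hyq : ‖y - q‖ < ρ / 4 := mem_ball_iff_norm.1 hy
    have hyn : ‖y‖ ≤ 1 - ρ / 4 := by
      have := norm_add_le (y - q) q
      rw [sub_add_cancel] at this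
      linarith
    have hyz : ‖y - z'‖ ≤ ρ := by
      have h1 : ‖q - z'‖ ≤ ρ / 2 := by
        have : q - z' = (-(ρ / 2)) • z' := by rw [hq]; module
        rw [this, norm_smul, norm_neg, Real.norm_of_nonneg (by linarith)]
        nlinarith
      have := norm_add_le (y - q) (q - z')
      rw [sub_add_sub_cancel] at this
      linarith
    have hw : ρ / 4 ≤ ballWeight y := by
      have := one_sub_norm_le_ballWeight (y := y) (by linarith)
      linarith
    have hHy : δ / 2 ≤ H y := by
      have hmv := Convex.norm_image_sub_le_of_norm_fderiv_le (𝕜 := ℝ) (f := f)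
        (fun x _ => (hf.differentiable (by norm_num)) x) hL (convex_closedBall x₀ r)
        (hmemb z' hz') (hmemb y (by linarith))
      rw [add_sub_add_left_eq_sub, ← smul_sub, norm_smul, Real.norm_of_nonneg hr.le,
        Real.norm_eq_abs] at hmv
      have h4 : L * (r * ‖y - z'‖) ≤ δ / 2 := by
        calc L * (r * ‖y - z'‖) ≤ L * (r * ρ) := by gcongr
          _ = δ / 2 := by rw [hρ]; field_simp
      have := (abs_le.1 hmv).2
      simp only [hH]
      linarith
    exact mul_le_mul hw hHy (by linarith) (ballWeight_nonneg y)
  have hvol : (volume (ball q (ρ / 4))).toReal = (ρ / 4) ^ d * v := by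
    rw [Measure.addHaar_ball_of_pos _ _ (by positivity), ENNReal.toReal_mul,
      ENNReal.toReal_ofReal (by positivity), finrank_euclideanSpace_fin]
  have hlower : (ρ / 4) ^ d * v * (ρ / 4 * (δ / 2)) ≤ ∫ y, ballWeight y * H y := by
    calc (ρ / 4) ^ d * v * (ρ / 4 * (δ / 2))
        = ∫ _ in ball q (ρ / 4), ρ / 4 * (δ / 2) := by
          rw [setIntegral_const, smul_eq_mul, Measure.real, hvol]
      _ ≤ ∫ y in ball q (ρ / 4), ballWeight y * H y :=
          setIntegral_mono_on (integrableOn_const measure_ball_lt_top.ne)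
            (integrable_ballWeight_mul hHc).integrableOn measurableSet_ball hball
      _ ≤ ∫ y, ballWeight y * H y :=
          setIntegral_le_integral (integrable_ballWeight_mul hHc) (Eventually.of_forall hwH)
  -- The power `d + 1` consists of `d` factors from the volume and one from the weight.
  have heq : (ρ / 4) ^ d * v * (ρ / 4 * (δ / 2)) =
      C * (v * (8 * r)⁻¹ ^ (d + 1) / (2 * C) * (δ / L) ^ (d + 1) * δ) := by
    have h5 : ρ / 4 = (8 * r)⁻¹ * (δ / L) := by rw [hρ]; field_simp; norm_num
    rw [h5, mul_pow]
    generalize (8 * r)⁻¹ = A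
    generalize δ / L = B
    field_simp
    ring
  have := mul_lt_mul_of_pos_left hη hC0
  linarith

/-- The local form of `sub_le_of_le_add_of_abs_laplacian_le`, for functions smooth near the
closed ball. -/
lemma sub_le_of_le_add_of_abs_laplacian_le_of_contDiffOn (d : ℕ) {r R : ℝ} (hr : 0 < r)
    (hrR : r < R) :
    ∃ c : ℝ, 0 < c ∧ ∀ (f : Eucl d → ℝ) (x₀ : Eucl d) (L η δ : ℝ), ContDiffOn ℝ 2 f (ball x₀ R) →
      (∀ x ∈ closedBall x₀ r, |Laplacian.laplacian f x| ≤ η) →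
      (∀ x ∈ closedBall x₀ r, ‖fderiv ℝ f x‖ ≤ L) →
      (∀ x ∈ closedBall x₀ r, f x ≤ f x₀ + η) →
      0 < δ → 0 < L → δ ≤ L * r → η < c * (δ / L) ^ (d + 1) * δ →
      ∀ x ∈ closedBall x₀ r, f x₀ + η - f x ≤ δ := by
  obtain ⟨c, hc, H⟩ := sub_le_of_le_add_of_abs_laplacian_le d hr
  refine ⟨c, hc, fun f x₀ L η δ hf hΔ hL hmax hδ hL0 hδL hη => ?_⟩
  -- The inner radius exceeds `r`, so `χ * f` and `f` have the same germ at each point of the closed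
  -- ball; the outer radius is below `R`, so `χ * f` is smooth everywhere.
  let χ : ContDiffBump x₀ :=
    { rIn := (2 * r + R) / 3, rOut := (r + 2 * R) / 3, rIn_pos := by linarith,
      rIn_lt_rOut := by linarith }
  have hg : ContDiff ℝ 2 fun x => χ x * f x := by
    rw [contDiff_iff_contDiffAt]
    intro x
    by_cases hx : x ∈ ball x₀ R
    · exact χ.contDiff.contDiffAt.mul (hf.contDiffAt (isOpen_ball.mem_nhds hx))
    · have hx' : x ∉ tsupport χ := by
        rw [χ.tsupport_eq]
        intro h
        rw [mem_closedBall] at h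
        rw [mem_ball] at hx
        change dist x x₀ ≤ (r + 2 * R) / 3 at h
        linarith
      refine (contDiffAt_const (c := (0 : ℝ))).congr_of_eventuallyEq ?_
      filter_upwards [notMem_tsupport_iff_eventuallyEq.1 hx'] with y hy
      simp [hy]
  have heq : ∀ x ∈ closedBall x₀ r, (fun x => χ x * f x) =ᶠ[𝓝 x] f := by
    intro x hx
    have : ball x₀ χ.rIn ∈ 𝓝 x := isOpen_ball.mem_nhds (by
      rw [mem_ball]
      rw [mem_closedBall] at hx
      change dist x x₀ < (2 * r + R) / 3
      linarith)
    filter_upwards [this] with y hy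
    rw [χ.one_of_mem_closedBall (ball_subset_closedBall hy), one_mul]
  have h0 := (heq x₀ (mem_closedBall_self hr.le)).eq_of_nhds
  intro x hx
  have := H _ x₀ L η δ hg
    (fun x hx => by
      rw [(InnerProductSpace.laplacian_congr_nhds (heq x hx)).eq_of_nhds]
      exact hΔ x hx)
    (fun x hx => by rw [(heq x hx).fderiv_eq]; exact hL x hx)
    (fun x hx => by
      have := (heq x hx).eq_of_nhds
      rw [this, h0]
      exact hmax x hx) hδ hL0 hδL hη x hx
  have h1 := (heq x hx).eq_of_nhds
  rwa [h0, h1] at this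

end MeanValue

/-! ### Asymptotics of nets -/

/-- A loss in the exponent absorbs any constant, which turns `O`-estimates into plain inequalities
between powers of `ε`. -/
lemma eventually_mul_rpow_lt (C : ℝ) {a b : ℝ} (h : a < b) :
    ∀ᶠ ε : Eps in toZero, C * (ε : ℝ) ^ b < (ε : ℝ) ^ a := by
  have h1 : Tendsto (fun ε : Eps => C * (ε : ℝ) ^ (b - a)) toZero (𝓝 0) := by
    have h2 : Tendsto (fun t : ℝ => C * t ^ (b - a)) (𝓝 0) (𝓝 0) := by
      have := ((Real.continuousAt_rpow_const 0 (b - a) (Or.inr (by linarith))).tendsto).const_mul C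
      rwa [Real.zero_rpow (by linarith), mul_zero] at this
    exact h2.comp tendsto_toZero
  filter_upwards [h1.eventually (gt_mem_nhds one_pos)] with ε hε
  calc C * (ε : ℝ) ^ b = C * (ε : ℝ) ^ (b - a) * (ε : ℝ) ^ a := by
        rw [mul_assoc, ← Real.rpow_add ε.2.1, sub_add_cancel]
    _ < 1 * (ε : ℝ) ^ a := mul_lt_mul_of_pos_right hε (Real.rpow_pos_of_pos ε.2.1 a)
    _ = _ := one_mul _

lemma rpow_le_rpow_of_le (ε : Eps) {a b : ℝ} (h : a ≤ b) : (ε : ℝ) ^ b ≤ (ε : ℝ) ^ a :=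
  Real.rpow_le_rpow_of_exponent_ge ε.2.1 ε.2.2 h

lemma eventually_norm_le_rpow_of_unifBigO {d : ℕ} {F : Type*} [Norm F] {f : Eps → Eucl d → F}
    {K : Set (Eucl d)} {a b : ℝ} (h : UnifBigO f K a) (hab : b < a) :
    ∀ᶠ ε in toZero, ∀ x ∈ K, ‖f ε x‖ ≤ (ε : ℝ) ^ b := by
  obtain ⟨C, hC⟩ := unifBigO_iff.1 h
  filter_upwards [hC, eventually_mul_rpow_lt C hab] with ε h1 h2 x hx
  exact (h1 x hx).trans h2.le

lemma mem_negligibleNum_iff {V : Type*} [NormedAddCommGroup V] [NormedSpace ℝ V] {c : Eps → V} :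
    c ∈ negligibleNum V ↔ ∀ b : ℝ, ∀ᶠ ε in toZero, ‖c ε‖ ≤ (ε : ℝ) ^ b := by
  constructor
  · intro h b
    obtain ⟨C, hC⟩ := (h (b + 1)).bound
    filter_upwards [hC, eventually_mul_rpow_lt C (lt_add_one b)] with ε h1 h2
    rw [Real.norm_of_nonneg (Real.rpow_nonneg ε.2.1.le _)] at h1
    exact h1.trans h2.le
  · intro h b
    refine IsBigO.of_bound 1 ?_
    filter_upwards [h b] with ε h1
    rwa [Real.norm_of_nonneg (Real.rpow_nonneg ε.2.1.le _), one_mul]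

lemma GenNum.mk_eq_mk_iff {V : Type*} [NormedAddCommGroup V] [NormedSpace ℝ V]
    {p q : moderateNum V} : GenNum.mk p = GenNum.mk q ↔
      ∀ b : ℝ, ∀ᶠ ε in toZero, ‖p.1 ε - q.1 ε‖ ≤ (ε : ℝ) ^ b :=
  (Submodule.Quotient.eq _).trans (mem_negligibleNum_iff (c := p.1 - q.1))

lemma GenNum.eventually_le_of_mk_le_mk {p q : moderateNum ℝ} (h : GenNum.mk p ≤ GenNum.mk q)
    (b : ℝ) : ∀ᶠ ε in toZero, p.1 ε ≤ q.1 ε + (ε : ℝ) ^ b := by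
  obtain ⟨p', q', hp, hq, hle⟩ := h
  filter_upwards [GenNum.mk_eq_mk_iff.1 hp (b + 1), GenNum.mk_eq_mk_iff.1 hq (b + 1),
    eventually_mul_rpow_lt 2 (lt_add_one b)] with ε h1 h2 h3
  rw [Real.norm_eq_abs] at h1 h2
  have := (abs_le.1 h1).1
  have := (abs_le.1 h2).2
  have := hle ε
  linarith

/-! ### Negligibility from the order-zero estimate -/

/-- A Landau inequality: the first derivative is controlled by the function and its second
derivative. -/
lemma norm_fderiv_le_of_norm_le_of_norm_fderiv_fderiv_le {E F : Type*} [NormedAddCommGroup E]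
    [NormedSpace ℝ E] [NormedAddCommGroup F] [NormedSpace ℝ F] {g : E → F} {x : E} {h η M : ℝ}
    (hh : 0 < h) (hg : ∀ y ∈ closedBall x h, DifferentiableAt ℝ g y)
    (hg' : ∀ y ∈ closedBall x h, DifferentiableAt ℝ (fderiv ℝ g) y)
    (hη : ∀ y ∈ closedBall x h, ‖g y‖ ≤ η)
    (hM : ∀ y ∈ closedBall x h, ‖fderiv ℝ (fderiv ℝ g) y‖ ≤ M) :
    ‖fderiv ℝ g x‖ ≤ 2 * η / h + h * M := by
  have hx : x ∈ closedBall x h := mem_closedBall_self hh.le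
  have hη0 : 0 ≤ η := (norm_nonneg _).trans (hη x hx)
  have hM0 : 0 ≤ M := (ContinuousLinearMap.opNorm_nonneg _).trans (hM x hx)
  refine ContinuousLinearMap.opNorm_le_bound _ (by positivity) fun v => ?_
  rcases eq_or_ne v 0 with rfl | hv
  · simp
  have hv0 : 0 < ‖v‖ := norm_pos_iff.2 hv
  -- Rescaling `v` to length `h` gives the longest step that stays in the ball; the first-order
  -- expansion along it is then divided by `h`.
  set w := (h / ‖v‖) • v with hw
  have hwn : ‖w‖ = h := by
    rw [hw, norm_smul, Real.norm_of_nonneg (by positivity), div_mul_cancel₀ _ hv0.ne']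
  have hxw : x + w ∈ closedBall x h := by
    rw [mem_closedBall_iff_norm, add_sub_cancel_left, hwn]
  have hD : ∀ y ∈ closedBall x h, ‖fderiv ℝ g y - fderiv ℝ g x‖ ≤ M * h := fun y hy =>
    (Convex.norm_image_sub_le_of_norm_fderiv_le (𝕜 := ℝ) hg' hM (convex_closedBall x h) hx
      hy).trans (mul_le_mul_of_nonneg_left (mem_closedBall_iff_norm.1 hy) hM0)
  have hT := Convex.norm_image_sub_le_of_norm_hasFDerivWithin_le' (𝕜 := ℝ) (f := g)
    (f' := fderiv ℝ g) (φ := fderiv ℝ g x)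
    (fun y hy => (hg y hy).hasFDerivAt.hasFDerivWithinAt) hD (convex_closedBall x h) hx hxw
  rw [add_sub_cancel_left, hwn] at hT
  have hDw : ‖fderiv ℝ g x w‖ ≤ 2 * η + M * h * h := by
    have h1 : fderiv ℝ g x w = g (x + w) - g x - (g (x + w) - g x - fderiv ℝ g x w) := by abel
    rw [h1]
    refine (norm_sub_le _ _).trans ?_
    have := norm_sub_le (g (x + w)) (g x)
    linarith [hη _ hxw, hη _ hx]
  have hvw : v = (‖v‖ / h) • w := by
    rw [hw, smul_smul, div_mul_div_cancel₀ hh.ne', div_self hv0.ne', one_smul]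
  calc ‖fderiv ℝ g x v‖ = ‖v‖ / h * ‖fderiv ℝ g x w‖ := by
        conv_lhs => rw [hvw]
        rw [map_smul, norm_smul, Real.norm_of_nonneg (by positivity)]
    _ ≤ ‖v‖ / h * (2 * η + M * h * h) := by gcongr
    _ = (2 * η / h + h * M) * ‖v‖ := by field_simp

section Functions

variable {d : ℕ} {V : Type*} [NormedAddCommGroup V] [NormedSpace ℝ V] {Ω : Opens (Eucl d)}

/-- A moderate net is negligible as soon as it satisfies the negligibility estimates of order
zero. -/
lemma mem_negligible_of_mem_moderate {u : Eps → Eucl d → V} (hu : u ∈ moderate V Ω)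
    (h0 : ∀ K : Set (Eucl d), IsCompact K → K ⊆ Ω → ∀ b : ℝ,
      ∀ᶠ ε in toZero, ∀ x ∈ K, ‖u ε x‖ ≤ (ε : ℝ) ^ b) : u ∈ negligible V Ω := by
  have main : ∀ (k : ℕ) (K : Set (Eucl d)), IsCompact K → K ⊆ Ω → ∀ b : ℝ,
      ∀ᶠ ε in toZero, ∀ x ∈ K, ‖iteratedFDeriv ℝ k (u ε) x‖ ≤ (ε : ℝ) ^ b := by
    intro k
    induction k with
    | zero => simpa only [norm_iteratedFDeriv_zero] using h0
    | succ k ih =>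
      intro K hK hKΩ b
      obtain ⟨r, hr, hrΩ⟩ := hK.exists_cthickening_subset_open Ω.isOpen hKΩ
      obtain ⟨a, ha⟩ := hu.2 (k + 2) _ (hK.cthickening (r := r)) hrΩ
      -- The Landau inequality is used with step `ε ^ B`. With `D^k u` bounded by `ε ^ (b + 1 + B)`
      -- the first term is `2 ε ^ (b + 1)`, and `B + a - 1 ≥ b + 1` bounds the second by `ε ^ (b +
      -- 1)`.
      set B := |a| + |b| + 3 with hB
      have hb1 := neg_abs_le b
      have hb2 := le_abs_self b
      have ha1 := neg_abs_le a
      filter_upwards [ih _ (hK.cthickening (r := r)) hrΩ (b + 1 + B),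
        eventually_norm_le_rpow_of_unifBigO (ha (k + 2) le_rfl) (sub_one_lt a),
        eventually_mul_rpow_lt 3 (lt_add_one b),
        eventually_mul_rpow_lt r⁻¹ (show (0 : ℝ) < B by positivity)] with ε h1 h2 h3 h4 x hx
      have hε := ε.2.1
      have hh : 0 < (ε : ℝ) ^ B := Real.rpow_pos_of_pos hε B
      have hhr : (ε : ℝ) ^ B ≤ r := by
        rw [Real.rpow_zero, inv_mul_lt_iff₀ hr, mul_one] at h4
        exact h4.le
      have hsub : closedBall x ((ε : ℝ) ^ B) ⊆ cthickening r K :=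
        (closedBall_subset_closedBall hhr).trans (closedBall_subset_cthickening hx r)
      have hcd : ∀ y ∈ closedBall x ((ε : ℝ) ^ B), ContDiffAt ℝ ∞ (u ε) y := fun y hy =>
        (hu.1 ε).contDiffAt (Ω.isOpen.mem_nhds (hrΩ (hsub hy)))
      have hcd' : ∀ y ∈ closedBall x ((ε : ℝ) ^ B), ContDiffAt ℝ 2 (iteratedFDeriv ℝ k (u ε)) y :=
        fun y hy => (hcd y hy).iteratedFDeriv_right (m := 2) (i := k) (by
          rw [show (2 : WithTop ℕ∞) + k = ((2 + k : ℕ) : WithTop ℕ∞) by push_cast; rfl]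
          exact WithTop.coe_le_coe.2 le_top)
      have hL := norm_fderiv_le_of_norm_le_of_norm_fderiv_fderiv_le (g := iteratedFDeriv ℝ k (u ε))
        hh (fun y hy => (hcd' y hy).differentiableAt (by norm_num))
        (fun y hy => ((hcd' y hy).fderiv_right (m := 1) (by norm_num)).differentiableAt
          (by norm_num))
        (fun y hy => h1 y (hsub hy)) (M := (ε : ℝ) ^ (a - 1))
        -- Up to the currying isometry, the derivative of `D^k u` is `D^(k+1) u`, so its second
        -- derivative is bounded by `D^(k+2) u`.
        (fun y hy => by
          have h5 := h2 y (hsub hy)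
          rw [← norm_fderiv_iteratedFDeriv] at h5
          rw [fderiv_iteratedFDeriv, LinearIsometryEquiv.comp_fderiv]
          refine le_trans ?_ h5
          refine ContinuousLinearMap.opNorm_le_bound _
            (ContinuousLinearMap.opNorm_nonneg _) fun v => ?_
          simpa using ContinuousLinearMap.le_opNorm _ v)
      rw [norm_fderiv_iteratedFDeriv] at hL
      refine hL.trans (le_trans ?_ h3.le)
      have e1 : 2 * (ε : ℝ) ^ (b + 1 + B) / (ε : ℝ) ^ B = 2 * (ε : ℝ) ^ (b + 1) := by
        rw [Real.rpow_add hε (b + 1) B]; field_simp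
      have e2 : (ε : ℝ) ^ B * (ε : ℝ) ^ (a - 1) ≤ (ε : ℝ) ^ (b + 1) := by
        rw [← Real.rpow_add hε]
        exact rpow_le_rpow_of_le ε (by rw [hB]; linarith)
      rw [e1]
      linarith
  refine ⟨hu.1, fun m K hK hKΩ b k _ => unifBigO_iff.2 ⟨1, ?_⟩⟩
  simpa only [one_mul] using main k K hK hKΩ b

end Functions

/-! ### The maximum principle for nets -/

section Nets

variable {d : ℕ} {Ω : Opens (Eucl d)} {u : Eps → Eucl d → ℝ} {l : Filter Eps} {m : Eps → ℝ}

/-- The quantitative principle at each `ε`, with `L = ε ^ (a - 1)`, `η = ε ^ N` and `δ = ε ^ B`. The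
filter `l`, the centres `y` and the level `m` are kept independent so that the estimate can be
passed on from one centre to another along an ultrafilter. -/
lemma eventually_abs_sub_le_of_le_add (hl : l ≤ toZero) (hu : u ∈ moderate ℝ Ω)
    (hΔ : (fun ε => Laplacian.laplacian (u ε)) ∈ negligible ℝ Ω) {r R : ℝ} (hr : 0 < r)
    (hrR : r < R) {K : Set (Eucl d)} (hK : IsCompact K) (hKΩ : K ⊆ Ω) {y : Eps → Eucl d}
    (hyK : ∀ᶠ ε in l, ball (y ε) R ⊆ K)
    (hmax : ∀ b : ℝ, ∀ᶠ ε in l, ∀ x ∈ closedBall (y ε) r, u ε x ≤ m ε + (ε : ℝ) ^ b)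
    (hy : ∀ b : ℝ, ∀ᶠ ε in l, |u ε (y ε) - m ε| ≤ (ε : ℝ) ^ b) (b : ℝ) :
    ∀ᶠ ε in l, ∀ x ∈ closedBall (y ε) r, |u ε x - m ε| ≤ (ε : ℝ) ^ b := by
  obtain ⟨c, hc, H⟩ := sub_le_of_le_add_of_abs_laplacian_le_of_contDiffOn d hr hrR
  obtain ⟨a, ha⟩ := hu.2 1 K hK hKΩ
  set A := 1 - a with hA
  -- `B ≥ b + 1` gives the required accuracy, and `B > a - 1` gives `δ ≤ L * r` for small `ε`. In
  -- `N`, the exponent of `(δ / L) ^ (d + 1) * δ` is raised by one to absorb `c`.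
  set B := max (b + 1) (a + 1) with hB
  set N := (B + A) * (d + 1 : ℕ) + B + 1 with hN
  filter_upwards [hyK, hmax (N + 1), hy (N + 1), hmax (b + 1), hy (b + 1),
    hl (eventually_norm_le_rpow_of_unifBigO (ha 1 le_rfl) (sub_one_lt a)),
    hl (eventually_norm_le_rpow_of_unifBigO (hΔ.2 0 K hK hKΩ (N + 1) 0 le_rfl) (lt_add_one N)),
    hl (eventually_mul_rpow_lt 2 (lt_add_one b)), hl (eventually_mul_rpow_lt 2 (lt_add_one N)),
    hl (eventually_mul_rpow_lt r⁻¹ (show a - 1 < B from (by linarith : a - 1 < a + 1).trans_le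
      (le_max_right _ _))),
    hl (eventually_mul_rpow_lt c⁻¹ (sub_one_lt N))]
    with ε hsub h1 h2 h3 h4 h5 h6 h7 h8 h9 h10 x hx
  have hε := ε.2.1
  have hcb : closedBall (y ε) r ⊆ K := (closedBall_subset_ball hrR).trans hsub
  have h2' := abs_le.1 h2
  have key := H (u ε) (y ε) ((ε : ℝ) ^ (a - 1)) ((ε : ℝ) ^ N) ((ε : ℝ) ^ B)
    (((hu.1 ε).mono (hsub.trans hKΩ)).of_le (WithTop.coe_le_coe.2 le_top))
    (fun z hz => by
      simpa only [norm_iteratedFDeriv_zero, Real.norm_eq_abs] using h6 z (hcb hz))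
    (fun z hz => by simpa only [norm_iteratedFDeriv_one] using h5 z (hcb hz))
    (fun z hz => by linarith [h1 z hz])
    (Real.rpow_pos_of_pos hε _) (Real.rpow_pos_of_pos hε _)
    (by rw [inv_mul_lt_iff₀ hr, mul_comm] at h9; exact h9.le)
    (by
      rw [inv_mul_lt_iff₀ hc] at h10
      rw [← Real.rpow_sub hε, ← Real.rpow_natCast, ← Real.rpow_mul hε.le, mul_assoc,
        ← Real.rpow_add hε]
      rwa [show N - 1 = (B - (a - 1)) * (d + 1 : ℕ) + B by rw [hN, hA]; ring] at h10) x hx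
  have h11 : (ε : ℝ) ^ B ≤ (ε : ℝ) ^ (b + 1) := rpow_le_rpow_of_le ε (le_max_left _ _)
  have h12 := Real.rpow_nonneg hε.le N
  have h4' := abs_le.1 h4
  have h13 := Real.rpow_nonneg hε.le (b + 1)
  rw [abs_le]
  constructor <;> linarith [h3 x hx]

/-- Maximum points of `u ε` on `S ε` form a generalized point; comparing its value with that at `x₀`
bounds `u ε` uniformly on `S ε`. -/
lemma eventually_le_of_forall_eval_le (hu : u ∈ moderate ℝ Ω) {x₀ : CompactNet Ω}
    {S : Eps → Set (Eucl d)} (hS : ∀ ε, IsCompact (S ε)) (hne : ∀ ε, (S ε).Nonempty)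
    (hSΩ : ∀ ε, S ε ⊆ Ω) {K : Set (Eucl d)} (hK : IsCompact K) (hKΩ : K ⊆ Ω)
    (hSK : ∀ᶠ ε in toZero, S ε ⊆ K)
    (hmax : ∀ t : CompactNet Ω, (∀ ε, t.1 ε ∈ S ε) →
      (GenFun.mk ⟨u, hu⟩).eval (CompactPoint.mk t) ≤
        (GenFun.mk ⟨u, hu⟩).eval (CompactPoint.mk x₀)) (b : ℝ) :
    ∀ᶠ ε in toZero, ∀ x ∈ S ε, u ε x ≤ u ε (x₀.1 ε) + (ε : ℝ) ^ b := by
  choose t htS ht using fun ε => (hS ε).exists_isMaxOn (hne ε)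
    ((hu.1 ε).continuousOn.mono (hSΩ ε))
  let t' : CompactNet Ω := ⟨t, fun ε => hSΩ ε (htS ε), K, hK, hKΩ, by
    filter_upwards [hSK] with ε h using h (htS ε)⟩
  filter_upwards [GenNum.eventually_le_of_mk_le_mk (p := ⟨_, eval_mem_moderateNum hu t'⟩)
    (q := ⟨_, eval_mem_moderateNum hu x₀⟩) (hmax t' htS) b] with ε h x hx
  exact (ht ε hx).trans h

/-- The strong maximum principle along an ultrafilter. -/
lemma eventually_abs_sub_le_of_isConnected {l : Ultrafilter Eps} (hl : (l : Filter Eps) ≤ toZero)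
    (hΩ : IsConnected (Ω : Set (Eucl d))) (hu : u ∈ moderate ℝ Ω)
    (hΔ : (fun ε => Laplacian.laplacian (u ε)) ∈ negligible ℝ Ω) (x₀ : CompactNet Ω)
    (hmax : ∀ K : Set (Eucl d), IsCompact K → K ⊆ Ω → ∀ b : ℝ,
      ∀ᶠ ε in toZero, ∀ x ∈ K, u ε x ≤ u ε (x₀.1 ε) + (ε : ℝ) ^ b)
    {K : Set (Eucl d)} (hK : IsCompact K) (hKΩ : K ⊆ Ω) (b : ℝ) :
    ∀ᶠ ε in l, ∀ x ∈ K, |u ε x - u ε (x₀.1 ε)| ≤ (ε : ℝ) ^ b := by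
  -- One neighbourhood serves all exponents `b`, so every point of its interior is again in `A`.
  set A : Set (Eucl d) := {p | ∃ U ∈ 𝓝 p, ∀ b : ℝ, ∀ᶠ ε in l, ∀ x ∈ U,
    |u ε x - u ε (x₀.1 ε)| ≤ (ε : ℝ) ^ b} with hA
  -- a net of points near `p` at which `u` almost attains its maximum puts `p` into `A`
  have step : ∀ p ∈ Ω, ∃ r > 0, ∀ y : Eps → Eucl d, (∀ᶠ ε in l, y ε ∈ closedBall p r) →
      (∀ b : ℝ, ∀ᶠ ε in l, |u ε (y ε) - u ε (x₀.1 ε)| ≤ (ε : ℝ) ^ b) → p ∈ A := by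
    intro p hp
    obtain ⟨R, hR, hRΩ⟩ := nhds_basis_closedBall.mem_iff.1 (Ω.isOpen.mem_nhds hp)
    -- For `y ε` within `R / 4` of `p`, the ball of radius `3 * R / 4` about `y ε` stays in
    -- `closedBall p R`, and the one of radius `R / 2` covers `closedBall p (R / 4)`.
    refine ⟨R / 4, by positivity, fun y hyp hy => ?_⟩
    have h := eventually_abs_sub_le_of_le_add (r := R / 2) (R := 3 * R / 4) hl hu hΔ
      (by linarith) (by linarith) (isCompact_closedBall p R) hRΩ (y := y)
      (hyp.mono fun ε hε x hx => by
        rw [mem_closedBall] at hε ⊢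
        rw [mem_ball] at hx
        linarith [dist_triangle x (y ε) p])
      (fun b => by
        filter_upwards [hl (hmax _ (isCompact_closedBall p R) hRΩ b), hyp] with ε h1 h2 x hx
        refine h1 x ?_
        rw [mem_closedBall] at h2 hx ⊢
        linarith [dist_triangle x (y ε) p]) hy
    refine ⟨closedBall p (R / 4), closedBall_mem_nhds p (by positivity), fun b => ?_⟩
    filter_upwards [h b, hyp] with ε h1 h2 x hx
    refine h1 x ?_
    rw [mem_closedBall] at h2 hx ⊢
    rw [dist_comm] at h2
    linarith [dist_triangle x p (y ε)]
  have hAo : IsOpen A := by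
    rw [isOpen_iff_mem_nhds]
    rintro p ⟨U, hU, h⟩
    filter_upwards [eventually_mem_nhds_iff.2 hU] with q hq
    exact ⟨U, hq, h⟩
  have hΩA : (Ω : Set (Eucl d)) ⊆ A := by
    refine hΩ.isPreconnected.subset_of_closure_inter_subset hAo ?_ ?_
    · obtain ⟨K₀, hK₀, hK₀Ω, hx₀⟩ := x₀.2.2
      -- This is where the ultrafilter is needed: along `l` the moving maximum point converges, and
      -- its limit lies in `A`.
      obtain ⟨p, hp, hlim⟩ := hK₀.ultrafilter_le_nhds' (l.map x₀.1) (hl hx₀)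
      obtain ⟨r, hr, h⟩ := step p (hK₀Ω hp)
      refine ⟨p, hK₀Ω hp, h x₀.1 (hlim (closedBall_mem_nhds p hr)) fun b => ?_⟩
      exact Eventually.of_forall fun ε => by simpa using Real.rpow_nonneg ε.2.1.le b
    · rintro p ⟨hpA, hpΩ⟩
      obtain ⟨r, hr, h⟩ := step p hpΩ
      obtain ⟨q, ⟨U, hU, hq⟩, hqp⟩ := Metric.mem_closure_iff.1 hpA r hr
      -- A point of `A` close to `p`, taken as a constant net, shows that `A` is relatively closed
      -- in `Ω`.
      refine h (fun _ => q) (Eventually.of_forall fun _ => ?_) fun b => ?_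
      · rw [mem_closedBall, dist_comm]; exact hqp.le
      · filter_upwards [hq b] with ε hε using hε q (mem_of_mem_nhds hU)
  refine hK.induction_on (p := fun s => ∀ᶠ ε in l, ∀ x ∈ s, |u ε x - u ε (x₀.1 ε)| ≤ (ε : ℝ) ^ b)
    (by simp) (fun s t hst h => h.mono fun ε h1 x hx => h1 x (hst hx))
    (fun s t hs ht => by
      filter_upwards [hs, ht] with ε h1 h2 x hx
      exact hx.elim (h1 x) (h2 x)) fun p hp => ?_
  obtain ⟨U, hU, h⟩ := hΩA (hKΩ hp)
  exact ⟨U, mem_nhdsWithin_of_mem_nhds hU, h b⟩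

end Nets

/-! ### From nets to generalized functions -/

lemma laplacian_mem_negligible_of_isHarmonic {d : ℕ} {V : Type*} [NormedAddCommGroup V]
    [NormedSpace ℝ V] {Ω : Opens (Eucl d)} {u : Eps → Eucl d → V} {hu : u ∈ moderate V Ω}
    (h : (GenFun.mk ⟨u, hu⟩).IsHarmonic) :
    (fun ε => Laplacian.laplacian (u ε)) ∈ negligible V Ω :=
  (Submodule.Quotient.mk_eq_zero ((negligible V Ω).submoduleOf (moderate V Ω))
    (x := (⟨_, laplacian_mem_moderate hu⟩ : moderate V Ω))).1 h

end Colombeau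

end

open Metric in
theorem mainTheorem9 {d : ℕ} (Ω : TopologicalSpace.Opens (Colombeau.Eucl d))
    (G : Colombeau.GenFun ℝ Ω) (hG : G.IsHarmonic) :
    (∀ (r : ℝ) (x₀ : Colombeau.CompactNet Ω), 0 < r →
      (∀ ε, Colombeau.CompactlyContained (Metric.ball (x₀.1 ε) (2 * r)) Ω) →
      (∀ t ∈ Colombeau.semiBall x₀ r, G.eval t ≤ G.eval (Colombeau.CompactPoint.mk x₀)) →
      ∃ c : Colombeau.GenNum ℝ, ∀ t ∈ Colombeau.semiBall x₀ r, G.eval t = c) ∧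
    (IsConnected (Ω : Set (Colombeau.Eucl d)) →
      (∃ x₀ : Colombeau.CompactPoint Ω, ∀ t : Colombeau.CompactPoint Ω,
        G.eval t ≤ G.eval x₀) →
      ∃ c : Colombeau.GenNum ℝ, G = Colombeau.GenFun.const Ω c) := by
  obtain ⟨⟨u, hu⟩, rfl⟩ := Submodule.Quotient.mk_surjective _ G
  have hΔ := Colombeau.laplacian_mem_negligible_of_isHarmonic hG
  refine ⟨fun r x₀ hr hball hmax => ?_, fun hΩ hmax => ?_⟩
  · obtain ⟨K₀, hK₀, hK₀Ω, hx₀⟩ := x₀.2.2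
    -- All balls of radius `3 * r / 2` about `x₀ ε`, for small `ε`, must lie in one compact subset
    -- of `Ω`. Each point of `Z` is within `r / 2` of some centre, and `3 * r / 2 + r / 2 = 2 * r`,
    -- the radius in the hypothesis.
    set Z := closure (Set.range x₀.1 ∩ K₀) with hZ
    have hZc : IsCompact Z := hK₀.closure_of_subset Set.inter_subset_right
    have hZΩ : cthickening (3 * r / 2) Z ⊆ Ω := by
      rw [hZc.cthickening_eq_biUnion_closedBall (by positivity)]
      refine Set.iUnion₂_subset fun z hz x hx => ?_
      obtain ⟨_, ⟨⟨ε, rfl⟩, -⟩, hε⟩ := Metric.mem_closure_iff.1 hz (r / 2) (by positivity)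
      refine (hball ε).2 (subset_closure ?_)
      rw [mem_closedBall] at hx
      rw [mem_ball]
      linarith [dist_triangle x z (x₀.1 ε)]
    have hsub : ∀ᶠ ε in Colombeau.toZero, closedBall (x₀.1 ε) (3 * r / 2) ⊆
        cthickening (3 * r / 2) Z := by
      filter_upwards [hx₀] with ε hε
      have hmem : x₀.1 ε ∈ Set.range x₀.1 ∩ K₀ := ⟨⟨ε, rfl⟩, hε⟩
      exact closedBall_subset_cthickening (subset_closure hmem) _
    have hmem : ∀ t : Colombeau.CompactNet Ω, (∀ ε, t.1 ε ∈ closedBall (x₀.1 ε) r) →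
        Colombeau.CompactPoint.mk t ∈ Colombeau.semiBall x₀ r := fun t ht =>
      ⟨t, rfl, fun ε => by rw [← dist_eq_norm, dist_comm]; exact ht ε⟩
    have hle := Colombeau.eventually_le_of_forall_eval_le hu (x₀ := x₀)
      (S := fun ε => closedBall (x₀.1 ε) r) (fun ε => isCompact_closedBall _ _)
      (fun ε => nonempty_closedBall.2 hr.le)
      (fun ε => (closedBall_subset_ball (by linarith)).trans (subset_closure.trans (hball ε).2))
      hZc.cthickening hZΩ
      (hsub.mono fun ε h => (closedBall_subset_closedBall (by linarith)).trans h)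
      (fun t ht => hmax _ (hmem t ht))
    have hconst := Colombeau.eventually_abs_sub_le_of_le_add le_rfl hu hΔ hr
      (show r < 3 * r / 2 by linarith) hZc.cthickening hZΩ
      (hsub.mono fun ε h => ball_subset_closedBall.trans h) hle
      (fun b => Filter.Eventually.of_forall fun ε => by
        simpa using Real.rpow_nonneg ε.2.1.le b)
    refine ⟨Colombeau.GenNum.mk ⟨_, Colombeau.eval_mem_moderateNum hu x₀⟩, ?_⟩
    rintro _ ⟨t, rfl, ht⟩
    refine Colombeau.GenNum.mk_eq_mk_iff (p := ⟨_, Colombeau.eval_mem_moderateNum hu t⟩).2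
      fun b => ?_
    filter_upwards [hconst b] with ε hε
    refine hε _ ?_
    rw [mem_closedBall, dist_comm, dist_eq_norm]
    exact ht ε
  · obtain ⟨x₀, hmax⟩ := hmax
    obtain ⟨x₀, rfl⟩ := Quotient.exists_rep x₀
    have hle : ∀ K : Set (Colombeau.Eucl d), IsCompact K → K ⊆ Ω → ∀ b : ℝ,
        ∀ᶠ ε in Colombeau.toZero, ∀ x ∈ K, u ε x ≤ u ε (x₀.1 ε) + (ε : ℝ) ^ b := by
      intro K hK hKΩ
      rcases K.eq_empty_or_nonempty with rfl | hne
      · simp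
      · exact Colombeau.eventually_le_of_forall_eval_le hu (S := fun _ => K) (fun _ => hK)
          (fun _ => hne) (fun _ => hKΩ) hK hKΩ (Filter.Eventually.of_forall fun _ => le_rfl)
          (fun t _ => hmax _)
    have hm := Colombeau.eval_mem_moderateNum hu x₀
    refine ⟨Colombeau.GenNum.mk ⟨_, hm⟩, ?_⟩
    -- Only the order-zero estimate for `u - u (x₀)` remains.
    refine (Submodule.Quotient.eq _).2 (Colombeau.mem_negligible_of_mem_moderate
      (sub_mem hu (Colombeau.const_mem_moderate hm)) fun K hK hKΩ b => ?_)
    -- A property holds for all small `ε` if it holds along every ultrafilter finer than `ε → 0`.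
    refine Filter.mem_iff_ultrafilter.2 fun l hl => ?_
    exact Colombeau.eventually_abs_sub_le_of_isConnected hl hΩ hu hΔ x₀ hle hK hKΩ b
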